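/- Let $n\ge 2$ have prime factorization $n=p_1^{\alpha_1}\cdots p_k^{\alpha_k}$ with distinct primes $p_i$ and all $\alpha_i\ge 1$. Put $r(n)=k+\#\{i:\alpha_i>1\}$ and $s(n)=\#\{i:\alpha_i=1\}$. For a set $D$ of divisors of $n$, all different from $n$, let $\mathrm{ICG}_n(D)$ be the graph with vertex set $\mathbb Z/n\mathbb Z$ in which $a$ and $b$ are adjacent if and only if $\gcd(a-b,n)\in D$. Call $D$ irredundant if $\mathrm{ICG}_n(D)$ is connected and every $d\in D$ has a prime factor $p$ of $n$ such that $p\nmid d$ and $p\mid e$ for every $e\in D\setminus\{d\}$. (a) For $1\le t\le k$, the maximum of $\mathrm{diam}(\mathrm{ICG}_n(D))$ over all irredundant $D$ with $|D|=t$ exists and equals $$ f(n,t)=\begin{cases} r(n), & t=k,\\ r(n)+1, & n\equiv 2 \pmod 4,\ s(n)\ge 2,\ k-\lfloor s(n)/2\rfloor\le t<k,\\ r(n), & n\not\equiv 2 \pmod 4,\ s(n)\ge 2,\ k-\lfloor s(n)/2\rfloor\le t<k,\\ 2t+1, & n \text{ even},\ s(n)\ge 2,\ t<k-\lfloor s(n)/2\rfloor,\\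 2t, & n \text{ odd},\ s(n)\ge 2,\ t<k-\lfloor s(n)/2\rfloor,\\ 2t+1, & n \text{ even},\ s(n)\le 1,\ t<k,\\ 2t, & n \text{ odd},\ s(n)\le 1,\ t<k. \end{cases} $$ (b) If $1\le t\le k$, and moreover $t<k$ or $n\not\equiv 2\pmod 4$, then $f(n,t)$ is also the maximum of $\mathrm{diam}(\mathrm{ICG}_n(D))$ over all $D$ with $|D|=t$ for which $\mathrm{ICG}_n(D)$ is connected. (c) The maximum of $\mathrm{diam}(\mathrm{ICG}_n(D))$ over all $D$, of any cardinality, for which $\mathrm{ICG}_n(D)$ is connected equals $r(n)+1$ if $n\equiv 2\pmod 4$ and $s(n)\ge 2$, and equals $r(n)$ otherwise. It is attained by some such $D$ with $|D|\le k$. -/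

import Mathlib

namespace IntegralCirculant

/-- The integral circulant graph `ICG_n(D)`: the circulant graph on `ℤ/nℤ` whose symbol set is
the union over `d ∈ D` of `{x : gcd(x, n) = d}`. -/
def icg (n : ℕ) (D : Finset ℕ) : SimpleGraph (ZMod n) :=
  SimpleGraph.circulantGraph {x : ZMod n | ∃ d ∈ D, Nat.gcd x.val n = d}

/-- `D` is a set of divisors of `n`, different from `n`, for which `ICG_n(D)` is connected. -/
def IsConnectedDivisorSet (n : ℕ) (D : Finset ℕ) : Prop :=
  D ⊆ n.properDivisors ∧ (icg n D).Connected

/-- Connected divisor sets in which every `d ∈ D` has a private prime: a prime factor `p` of `n`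
that does not divide `d` but divides all the other elements of `D`. -/
def IsIrredundant (n : ℕ) (D : Finset ℕ) : Prop :=
  IsConnectedDivisorSet n D ∧
    ∀ d ∈ D, ∃ p ∈ n.primeFactors, ¬ p ∣ d ∧ ∀ e ∈ D, e ≠ d → p ∣ e

/-- The number `k` of distinct prime factors of `n`. -/
def numPrimes (n : ℕ) : ℕ := n.primeFactors.card

/-- `s(n)`: the number of primes that divide `n` exactly once. -/
def s (n : ℕ) : ℕ := (n.primeFactors.filter fun p => n.factorization p = 1).card

/-- `r(n) = k + #{i : α_i > 1}`. -/
def r (n : ℕ) : ℕ :=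
  numPrimes n + (n.primeFactors.filter fun p => 1 < n.factorization p).card

/-- The seven-case value, for `1 ≤ t ≤ k`. -/
def maxDiamValue (n t : ℕ) : ℕ :=
  if t = numPrimes n then r n
  else if 2 ≤ s n then
    if numPrimes n - s n / 2 ≤ t then
      if n % 4 = 2 then r n + 1 else r n
    else
      if Even n then 2 * t + 1 else 2 * t
  else
    if Even n then 2 * t + 1 else 2 * t

/-- `r(n) + 1` if `n ≡ 2 (mod 4)` and `s(n) ≥ 2`, and `r(n)` otherwise. -/
def overallMaxValue (n : ℕ) : ℕ :=
  if n % 4 = 2 ∧ 2 ≤ s n then r n + 1 else r n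

end IntegralCirculant

namespace IntegralCirculant

open Finset

/-! A walk from `a` to `b` is a list of integers whose gcds with `n` lie in `D` and whose sum is `b
- a` modulo `n`. By the Chinese remainder theorem, whether prescribed numbers of uses of the
divisors suffice can be tested prime by prime. At an odd `p`, two steps prime to `p` reach
everything; one such step, the rest being multiples of `p`, reaches the non-multiples of `p`; none
is enough for multiples of `p` if `p` has exponent one. At 2, parity must agree
(`edist_add_le_of_reaches`).

Connectedness means that no prime factor of `n` divides all of `D`. Using every divisor twice, plus
perhaps one odd step, bounds the diameter by `2t` or `2t + 1` (`Covers.ediam_le`). Private primes of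
exponent one save steps and give `r n` or `r n + 1` (`ediam_le_of_private`). For `t < k` the formula
is the smaller of the two bounds.

For sharpness, partition the primes into `t` classes and attach to each class the part of `n` prime
to it. Divisibility of the target by the primes of a class forces a number of uses of its divisor
(`exists_counts_of_walk`, `exists_isIrredundant_card_lt`).

A general connected `D` contains an irredundant subset, whose graph has fewer edges and hence at
least the same diameter; monotonicity of the formula in `t` finishes. -/

/-! ### Walks as sums of integers. -/

lemma gcd_val_intCast {n : ℕ} [NeZero n] (y : ℤ) :
    Nat.gcd (y : ZMod n).val n = Int.gcd y n := by
  rw [← Int.gcd_natCast_natCast, ZMod.val_intCast, Int.gcd_emod]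

lemma icg_adj_add_intCast {n : ℕ} [NeZero n] {D : Finset ℕ} (hD : D ⊆ n.properDivisors)
    (a : ZMod n) {y : ℤ} (hy : Int.gcd y n ∈ D) : (icg n D).Adj a (a + y) := by
  have hlt := (Nat.mem_properDivisors.1 (hD hy)).2
  rw [icg, SimpleGraph.circulantGraph_adj]
  refine ⟨fun h => ?_, Or.inr ⟨_, hy, ?_⟩⟩
  · have h0 : ((y : ℤ) : ZMod n) = 0 := by simpa using h.symm
    have := gcd_val_intCast (n := n) y
    rw [h0] at this
    simp at this
    omega
  · rw [add_sub_cancel_left, gcd_val_intCast]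

lemma exists_intCast_eq_sub_of_adj {n : ℕ} [NeZero n] {D : Finset ℕ} {a b : ZMod n}
    (h : (icg n D).Adj a b) : ∃ y : ℤ, (y : ZMod n) = b - a ∧ Int.gcd y n ∈ D := by
  rw [icg, SimpleGraph.circulantGraph_adj] at h
  obtain ⟨-, ⟨d, hd, h⟩ | ⟨d, hd, h⟩⟩ := h
  · refine ⟨-((a - b).val : ℤ), by simp, ?_⟩
    rwa [Int.neg_gcd, Int.gcd_natCast_natCast, h]
  · refine ⟨((b - a).val : ℤ), by simp, ?_⟩
    rwa [Int.gcd_natCast_natCast, h]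

lemma edist_add_sum_le {n : ℕ} [NeZero n] {D : Finset ℕ} (hD : D ⊆ n.properDivisors)
    {ι : Type*} (y : ι → ℤ) (a : ZMod n) (t : Finset ι) (hy : ∀ i ∈ t, Int.gcd (y i) n ∈ D) :
    (icg n D).edist a (a + ((∑ i ∈ t, y i : ℤ) : ZMod n)) ≤ (t.card : ℕ∞) := by
  classical
  induction t using Finset.induction_on with
  | empty => simp
  | insert i t hi ih =>
    have h1 := ih fun j hj => hy j (mem_insert_of_mem hj)
    have h2 := icg_adj_add_intCast hD (a + ((∑ i ∈ t, y i : ℤ) : ZMod n))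
      (hy i (mem_insert_self i t))
    rw [sum_insert hi, card_insert_of_notMem hi]
    have h3 : a + ((y i + ∑ i ∈ t, y i : ℤ) : ZMod n) =
        a + ((∑ i ∈ t, y i : ℤ) : ZMod n) + ((y i : ℤ) : ZMod n) := by
      push_cast; ring
    rw [h3]
    refine (SimpleGraph.edist_triangle (v := a + ((∑ i ∈ t, y i : ℤ) : ZMod n))).trans ?_
    rw [Nat.cast_add, Nat.cast_one]
    exact add_le_add h1 (SimpleGraph.edist_eq_one_iff_adj.2 h2).le

/-! ### Local solvability and the Chinese remainder theorem. -/

/-- `y` and `d` are divisible by the same powers `p ^ j` with `j ≤ a`. -/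
def SamePowers (p a : ℕ) (y : ℤ) (d : ℕ) : Prop :=
  ∀ j ≤ a, ((p ^ j : ℕ) : ℤ) ∣ y ↔ p ^ j ∣ d

lemma samePowers_natCast (p a d : ℕ) : SamePowers p a d d := fun _ _ => Int.natCast_dvd_natCast

lemma samePowers_of_not_dvd {p : ℕ} (a : ℕ) {y : ℤ} {d : ℕ} (hy : ¬ (p : ℤ) ∣ y) (hd : ¬ p ∣ d) :
    SamePowers p a y d := by
  intro j _
  rcases Nat.eq_zero_or_pos j with rfl | hj
  · simp
  · refine ⟨fun h => absurd ?_ hy, fun h => absurd ((dvd_pow_self p hj.ne').trans h) hd⟩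
    exact (Int.natCast_dvd_natCast.2 (dvd_pow_self p hj.ne')).trans h

lemma gcd_eq_of_samePowers {n : ℕ} (hn : n ≠ 0) {y : ℤ} {d : ℕ} (hd : d ∣ n)
    (h : ∀ p ∈ n.primeFactors, SamePowers p (n.factorization p) y d) : Int.gcd y n = d := by
  have key : ∀ p j : ℕ, p.Prime → p ^ j ∣ n → (p ^ j ∣ Int.gcd y n ↔ p ^ j ∣ d) := by
    intro p j hp hj
    rcases Nat.eq_zero_or_pos j with rfl | h0
    · simp
    have hpn : p ∈ n.primeFactors :=
      Nat.mem_primeFactors.2 ⟨hp, (dvd_pow_self p h0.ne').trans hj, hn⟩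
    rw [← h p hpn j ((hp.pow_dvd_iff_le_factorization hn).1 hj)]
    refine ⟨fun h => ?_, fun h => ?_⟩
    · exact (Int.natCast_dvd_natCast.2 h).trans (Int.gcd_dvd_left _ _)
    · exact Int.dvd_gcd h (Int.natCast_dvd_natCast.2 hj)
  have hg : Int.gcd y n ∣ n := Int.natCast_dvd_natCast.1 (Int.gcd_dvd_right _ _)
  apply Nat.dvd_antisymm
  · rw [Nat.dvd_iff_prime_pow_dvd_dvd]
    exact fun p j hp h => (key p j hp (h.trans hg)).1 h
  · rw [Nat.dvd_iff_prime_pow_dvd_dvd]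
    exact fun p j hp h => (key p j hp (h.trans hd)).2 h

/-- `x` is modulo `p ^ a` a sum of numbers with the same powers as the `d i`. -/
def LocalSum (p a : ℕ) {ι : Type*} [Fintype ι] (d : ι → ℕ) (x : ℤ) : Prop :=
  ∃ z : ι → ℤ, (∀ i, SamePowers p a (z i) (d i)) ∧ ((p ^ a : ℕ) : ℤ) ∣ (∑ i, z i) - x

/-- Fix all summands but the `i`-th and solve for that one; it only has to come out prime to `p`. -/
lemma localSum_of_update {p a : ℕ} {ι : Type*} [Fintype ι] [DecidableEq ι] {d : ι → ℕ} {x : ℤ}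
    (z : ι → ℤ) (i : ι) (hz : ∀ j, j ≠ i → SamePowers p a (z j) (d j)) (hd : ¬ p ∣ d i)
    (hx : ¬ (p : ℤ) ∣ x - ∑ j ∈ univ.erase i, z j) : LocalSum p a d x := by
  refine ⟨Function.update z i (x - ∑ j ∈ univ.erase i, z j), fun j => ?_, ?_⟩
  · rcases eq_or_ne j i with rfl | hj
    · rw [Function.update_self]
      exact samePowers_of_not_dvd a hx hd
    · rw [Function.update_of_ne hj]
      exact hz j hj
  · rw [← add_sum_erase _ _ (mem_univ i), Function.update_self,
      sum_congr rfl fun j hj => Function.update_of_ne (ne_of_mem_erase hj) _ z]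
    simp

/-- If solving for the `i`-th summand gives a multiple of `p`, replacing `d j` by `2 * d j` shifts
it by the unit `d j`; oddness of `p` keeps `2 * d j` prime to `p`. -/
lemma localSum_of_pair {p a : ℕ} (hp : p.Prime) (hp2 : p ≠ 2) {ι : Type*} [Fintype ι]
    [DecidableEq ι] {d : ι → ℕ} (x : ℤ) {i j : ι} (hij : i ≠ j) (hi : ¬ p ∣ d i) (hj : ¬ p ∣ d j) :
    LocalSum p a d x := by
  have hji : j ∈ univ.erase i := mem_erase.2 ⟨hij.symm, mem_univ j⟩
  by_cases h : (p : ℤ) ∣ x - ∑ l ∈ univ.erase i, (d l : ℤ)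
  · refine localSum_of_update (Function.update (fun l => (d l : ℤ)) j (2 * d j)) i ?_ hi ?_
    · intro l _
      rcases eq_or_ne l j with rfl | hl
      · rw [Function.update_self]
        refine samePowers_of_not_dvd a (fun h2 => ?_) hj
        have h2' : p ∣ 2 * d l := by exact_mod_cast h2
        rcases hp.dvd_mul.1 h2' with h3 | h3
        · exact hp2 ((Nat.prime_dvd_prime_iff_eq hp Nat.prime_two).1 h3)
        · exact hj h3
      · rw [Function.update_of_ne hl]
        exact samePowers_natCast _ _ _
    · intro h2
      apply hj
      rw [← add_sum_erase _ _ hji] at h h2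
      rw [Function.update_self,
        sum_congr rfl fun l hl => Function.update_of_ne (ne_of_mem_erase hl) _ _] at h2
      have := dvd_sub h h2
      ring_nf at this
      exact_mod_cast this
  · exact localSum_of_update (fun l => (d l : ℤ)) i (fun l _ => samePowers_natCast _ _ _) hi h

lemma exists_int_forall_sub_dvd (n : ℕ) (z : ℕ → ℤ) :
    ∃ y : ℤ, ∀ p ∈ n.primeFactors, ((p ^ n.factorization p : ℕ) : ℤ) ∣ y - z p := by
  obtain ⟨y, hy⟩ := IsDedekindDomain.exists_forall_sub_mem_ideal (s := n.primeFactors)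
    (fun p : ℕ => Ideal.span {(p : ℤ)}) n.factorization
    (fun p hp => by
      have hp' := Nat.prime_of_mem_primeFactors hp
      have h0 : (p : ℤ) ≠ 0 := by exact_mod_cast hp'.ne_zero
      exact Ideal.prime_of_isPrime (by simpa using h0)
        ((Ideal.span_singleton_prime h0).2 (Nat.prime_iff_prime_int.1 hp')))
    (fun p _ q _ hpq h => hpq (by
      have := Int.associated_iff_natAbs.1 (Ideal.span_singleton_eq_span_singleton.1 h)
      simpa using this))
    (fun p => z p)
  refine ⟨y, fun p hp => ?_⟩
  have := hy p hp
  rw [Ideal.span_singleton_pow, Ideal.mem_span_singleton] at this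
  exact_mod_cast this

/-- The local summands are glued index by index; the gcd with `n` survives because it is determined
by the prime powers dividing both. -/
lemma edist_add_le_of_localSum {n : ℕ} [NeZero n] {D : Finset ℕ} (hD : D ⊆ n.properDivisors)
    {ι : Type*} [Fintype ι] (d : ι → ℕ) (hd : ∀ i, d i ∈ D) (x : ℤ)
    (h : ∀ p ∈ n.primeFactors, LocalSum p (n.factorization p) d x) (a : ZMod n) :
    (icg n D).edist a (a + (x : ZMod n)) ≤ (Fintype.card ι : ℕ∞) := by
  choose! z hz hzx using h
  choose y hy using fun i => exists_int_forall_sub_dvd n fun p => z p i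
  have hgcd : ∀ i, Int.gcd (y i) n = d i := by
    intro i
    refine gcd_eq_of_samePowers (NeZero.ne n) (Nat.mem_properDivisors.1 (hD (hd i))).1 ?_
    intro p hp j hj
    rw [← hz p hp i j hj]
    exact dvd_iff_dvd_of_dvd_sub
      ((Int.natCast_dvd_natCast.2 (pow_dvd_pow p hj)).trans (hy i p hp))
  have hsum : (n : ℤ) ∣ (∑ i, y i) - x := by
    have : n ∣ ((∑ i, y i) - x).natAbs := by
      rw [Nat.dvd_iff_prime_pow_dvd_dvd]
      intro p j hp hj
      rcases Nat.eq_zero_or_pos j with rfl | h0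
      · simp
      have hpn : p ∈ n.primeFactors :=
        Nat.mem_primeFactors.2 ⟨hp, (dvd_pow_self p h0.ne').trans hj, NeZero.ne n⟩
      have hj' := (hp.pow_dvd_iff_le_factorization (NeZero.ne n)).1 hj
      refine (pow_dvd_pow p hj').trans (Int.natCast_dvd.1 ?_)
      have h1 : ((p ^ n.factorization p : ℕ) : ℤ) ∣ ∑ i, (y i - z p i) :=
        dvd_sum fun i _ => hy i p hpn
      have h2 := dvd_add h1 (hzx p hpn)
      rwa [sum_sub_distrib, sub_add_sub_cancel] at h2
    exact Int.natCast_dvd.2 this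
  have hx : ((∑ i, y i : ℤ) : ZMod n) = x := by
    rw [← sub_eq_zero, ← Int.cast_sub, ZMod.intCast_zmod_eq_zero_iff_dvd]
    exact hsum
  have := edist_add_sum_le hD y a univ fun i _ => (hgcd i).symm ▸ hd i
  rwa [hx] at this

/-! ### Numbers of uses that suffice to reach a vertex. -/

/-- Local conditions at the prime `p` under which `x` is reached by using every `d ∈ D` exactly
`u d` times. -/
def Reaches (n : ℕ) (D : Finset ℕ) (u : ℕ → ℕ) (x : ℤ) (p : ℕ) : Prop :=
  (n.factorization p = 1 ∧ (p : ℤ) ∣ x ∧ ∀ d ∈ D, u d ≠ 0 → p ∣ d) ∨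
  (p ≠ 2 ∧ ∃ d ∈ D, ¬ p ∣ d ∧ 2 ≤ u d) ∨
  (¬ (p : ℤ) ∣ x ∧ ∃ d ∈ D, ¬ p ∣ d ∧ u d = 1 ∧ ∀ e ∈ D, e ≠ d → u e ≠ 0 → p ∣ e) ∨
  (p = 2 ∧ (∃ d ∈ D, ¬ 2 ∣ d ∧ u d ≠ 0) ∧ (2 : ℤ) ∣ (∑ d ∈ D, (u d : ℤ) * d) - x)

lemma edist_add_le_of_reaches {n : ℕ} [NeZero n] {D : Finset ℕ} (hD : D ⊆ n.properDivisors)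
    (u : ℕ → ℕ) (x : ℤ) (h : ∀ p ∈ n.primeFactors, Reaches n D u x p) (a : ZMod n) :
    (icg n D).edist a (a + (x : ZMod n)) ≤ ((∑ d ∈ D, u d : ℕ) : ℕ∞) := by
  -- One summand for each use of each divisor.
  have key := edist_add_le_of_localSum hD (ι := Σ d : D, Fin (u d)) (fun i => (i.1 : ℕ))
    (fun i => i.1.2) x ?_ a
  · rw [Fintype.card_sigma] at key
    simp only [Fintype.card_fin] at key
    rwa [univ_eq_attach, sum_attach D u] at key
  intro p hp
  have hp' := Nat.prime_of_mem_primeFactors hp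
  rcases h p hp with ⟨h1, hx, hu⟩ | ⟨h2, d, hd, hpd, hu⟩ | ⟨hx, d, hd, hpd, hu, he⟩ |
    ⟨rfl, ⟨d, hd, hpd, hu⟩, hx⟩
  · refine ⟨fun i => (i.1 : ℕ), fun i => samePowers_natCast _ _ _, ?_⟩
    rw [h1, pow_one]
    refine dvd_sub (dvd_sum fun i _ => Int.natCast_dvd_natCast.2 (hu _ i.1.2 ?_)) hx
    exact (Fin.pos i.2).ne'
  · exact localSum_of_pair hp' h2 x (i := ⟨⟨d, hd⟩, ⟨0, by dsimp only; omega⟩⟩)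
      (j := ⟨⟨d, hd⟩, ⟨1, by dsimp only; omega⟩⟩) (by simp) hpd hpd
  · refine localSum_of_update (fun i => ((i.1 : ℕ) : ℤ)) ⟨⟨d, hd⟩, ⟨0, by dsimp only; omega⟩⟩
      (fun j _ => samePowers_natCast _ _ _) hpd fun h => hx ?_
    refine (dvd_iff_dvd_of_dvd_sub ?_).1 h
    rw [sub_sub_cancel_left]
    refine (dvd_neg.2 (dvd_sum fun i hi => Int.natCast_dvd_natCast.2 (he _ i.1.2 ?_ ?_)))
    · rintro h3
      obtain ⟨⟨e, he'⟩, l⟩ := i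
      simp only at h3
      subst h3
      apply (mem_erase.1 hi).1
      congr 1
      have := l.2
      apply Fin.ext
      simp only at this ⊢
      omega
    · exact (Fin.pos i.2).ne'
  · refine localSum_of_update (fun i => ((i.1 : ℕ) : ℤ)) ⟨⟨d, hd⟩, ⟨0, by dsimp only; omega⟩⟩
      (fun j _ => samePowers_natCast _ _ _) hpd ?_
    have hs : ∑ i : (Σ d : D, Fin (u d)), ((i.1 : ℕ) : ℤ) = ∑ d ∈ D, (u d : ℤ) * d := by
      rw [Fintype.sum_sigma]
      simp only [sum_const, card_univ, Fintype.card_fin, nsmul_eq_mul]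
      rw [univ_eq_attach, sum_attach D fun d => (u d : ℤ) * d]
    -- Parity of the total makes `x` minus the other summands odd, as the solved summand must be.
    rw [← add_sum_erase _ _
      (mem_univ (⟨⟨d, hd⟩, ⟨0, by dsimp only; omega⟩⟩ : Σ d : D, Fin (u d)))] at hs
    simp only at hs
    rw [← hs] at hx
    push_cast
    omega

/-! ### Connectedness and the bound by twice the number of divisors. -/

/-- Every prime factor of `n` fails to divide some element of `D`. -/
def Covers (n : ℕ) (D : Finset ℕ) : Prop := ∀ p ∈ n.primeFactors, ∃ d ∈ D, ¬ p ∣ d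

/-- If `p` divided all of `D`, walks would preserve the residue modulo `p`, separating 0 from 1. -/
lemma IsConnectedDivisorSet.covers {n : ℕ} [NeZero n] {D : Finset ℕ}
    (h : IsConnectedDivisorSet n D) : Covers n D := by
  intro p hp
  by_contra! hD
  have hp' := Nat.prime_of_mem_primeFactors hp
  have hpn := Nat.dvd_of_mem_primeFactors hp
  have key : ∀ a b : ZMod n, (icg n D).Walk a b →
      ZMod.castHom hpn (ZMod p) a = ZMod.castHom hpn (ZMod p) b := by
    intro a b w
    induction w with
    | nil => rfl
    | cons hadj _ ih =>
      rw [← ih]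
      obtain ⟨y, hy, hyD⟩ := exists_intCast_eq_sub_of_adj hadj
      rw [eq_comm, ← sub_eq_zero, ← map_sub, ← hy, map_intCast, ZMod.intCast_zmod_eq_zero_iff_dvd]
      exact (Int.natCast_dvd_natCast.2 (hD _ hyD)).trans (Int.gcd_dvd_left _ _)
  obtain ⟨w⟩ := h.2.preconnected 0 1
  have h01 := key _ _ w
  have : Fact p.Prime := ⟨hp'⟩
  rw [map_zero, map_one] at h01
  exact zero_ne_one h01

lemma ediam_le_of_reaches {n : ℕ} [NeZero n] {D : Finset ℕ} (hD : D ⊆ n.properDivisors) (m : ℕ)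
    (h : ∀ x : ℤ, ∃ u : ℕ → ℕ, (∀ p ∈ n.primeFactors, Reaches n D u x p) ∧ ∑ d ∈ D, u d ≤ m) :
    (icg n D).ediam ≤ (m : ℕ∞) := by
  refine SimpleGraph.ediam_le_of_edist_le fun a b => ?_
  obtain ⟨u, hu, hm⟩ := h ((b - a).val : ℤ)
  have := edist_add_le_of_reaches hD u _ hu a
  have hb : a + (((b - a).val : ℤ) : ZMod n) = b := by simp
  rw [hb] at this
  exact this.trans (by exact_mod_cast hm)

/-- Repeating the only step prime to an odd `p` turns the third alternative into the second. -/
lemma Reaches.update {n : ℕ} {D : Finset ℕ} {u : ℕ → ℕ} {x : ℤ} {p : ℕ} (h : Reaches n D u x p)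
    (hp : p ≠ 2) {e : ℕ} (he : u e ≠ 0) : Reaches n D (Function.update u e (u e + 1)) x p := by
  have h0 : ∀ d, Function.update u e (u e + 1) d ≠ 0 → u d ≠ 0 := by
    intro d hd
    rcases eq_or_ne d e with rfl | hde
    · exact he
    · rwa [Function.update_of_ne hde] at hd
  have h1 : ∀ d, u d ≤ Function.update u e (u e + 1) d := by
    intro d
    rcases eq_or_ne d e with rfl | hde
    · simp
    · rw [Function.update_of_ne hde]
  rcases h with ⟨h2, hx, hu⟩ | ⟨h2, d, hd, hpd, hu⟩ | ⟨hx, d, hd, hpd, hu, hf⟩ | ⟨rfl, -⟩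
  · exact Or.inl ⟨h2, hx, fun d hd hd0 => hu d hd (h0 d hd0)⟩
  · exact Or.inr (Or.inl ⟨h2, d, hd, hpd, hu.trans (h1 d)⟩)
  · rcases eq_or_ne d e with rfl | hde
    · exact Or.inr (Or.inl ⟨hp, d, hd, hpd, by simp [hu]⟩)
    · exact Or.inr (Or.inr (Or.inl ⟨hx, d, hd, hpd, by rwa [Function.update_of_ne hde],
        fun f hfD hfd hf0 => hf f hfD hfd (h0 f hf0)⟩))
  · exact absurd rfl hp

lemma sum_update_add_one {R : Type*} [Semiring R] {D : Finset ℕ} (u : ℕ → ℕ) {e : ℕ} (he : e ∈ D)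
    (c : ℕ → R) : ∑ d ∈ D, (Function.update u e (u e + 1) d : R) * c d =
      ∑ d ∈ D, (u d : R) * c d + c e := by
  rw [← add_sum_erase _ _ he, ← add_sum_erase _ _ he, Function.update_self,
    sum_congr rfl fun d hd => by rw [Function.update_of_ne (ne_of_mem_erase hd)]]
  push_cast
  rw [add_mul, one_mul, add_right_comm]

/-- One additional odd step repairs the parity. -/
lemma exists_reaches_of_odd {n : ℕ} {D : Finset ℕ} {u : ℕ → ℕ} {x : ℤ}
    (h : ∀ p ∈ n.primeFactors, p ≠ 2 → Reaches n D u x p) {e : ℕ} (heD : e ∈ D) (he : ¬ 2 ∣ e)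
    (hue : u e ≠ 0) :
    ∃ u' : ℕ → ℕ, (∀ p ∈ n.primeFactors, Reaches n D u' x p) ∧
      ∑ d ∈ D, u' d ≤ ∑ d ∈ D, u d + 1 := by
  by_cases hx : (2 : ℤ) ∣ (∑ d ∈ D, (u d : ℤ) * d) - x
  · refine ⟨u, fun p hp => ?_, Nat.le_succ _⟩
    rcases eq_or_ne p 2 with rfl | hp2
    · exact Or.inr (Or.inr (Or.inr ⟨rfl, ⟨e, heD, he, hue⟩, hx⟩))
    · exact h p hp hp2
  · refine ⟨Function.update u e (u e + 1), fun p hp => ?_, ?_⟩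
    · rcases eq_or_ne p 2 with rfl | hp2
      · refine Or.inr (Or.inr (Or.inr ⟨rfl, ⟨e, heD, he, by simp⟩, ?_⟩))
        rw [sum_update_add_one u heD fun d => (d : ℤ)]
        omega
      · exact (h p hp hp2).update hp2 hue
    · have := sum_update_add_one u heD fun _ => (1 : ℕ)
      simp only [Nat.cast_id, mul_one] at this
      exact this.le

lemma two_mem_primeFactors {n : ℕ} (hn : n ≠ 0) : 2 ∈ n.primeFactors ↔ Even n := by
  rw [Nat.mem_primeFactors, even_iff_two_dvd]
  exact ⟨fun h => h.2.1, fun h => ⟨Nat.prime_two, h, hn⟩⟩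

lemma Covers.ediam_le {n : ℕ} [NeZero n] {D : Finset ℕ} (hD : D ⊆ n.properDivisors)
    (h : Covers n D) :
    (icg n D).ediam ≤ ((if Even n then 2 * D.card + 1 else 2 * D.card : ℕ) : ℕ∞) := by
  refine ediam_le_of_reaches hD _ fun x => ?_
  have h2 : ∀ p ∈ n.primeFactors, p ≠ 2 → Reaches n D (fun _ => 2) x p := by
    intro p hp hp2
    obtain ⟨d, hd, hpd⟩ := h p hp
    exact Or.inr (Or.inl ⟨hp2, d, hd, hpd, le_rfl⟩)
  split_ifs with hn
  · obtain ⟨e, heD, he⟩ := h 2 ((two_mem_primeFactors (NeZero.ne n)).2 hn)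
    obtain ⟨u, hu, hs⟩ := exists_reaches_of_odd h2 heD he two_ne_zero
    exact ⟨u, hu, hs.trans (by simp [mul_comm])⟩
  · refine ⟨fun _ => 2, fun p hp => h2 p hp ?_, by simp [mul_comm]⟩
    rintro rfl
    exact hn ((two_mem_primeFactors (NeZero.ne n)).1 hp)

lemma Covers.connected {n : ℕ} [NeZero n] {D : Finset ℕ} (hD : D ⊆ n.properDivisors)
    (h : Covers n D) : IsConnectedDivisorSet n D :=
  ⟨hD, SimpleGraph.connected_of_ediam_ne_top
    (ne_top_of_le_ne_top (ENat.natCast_ne_top _) (h.ediam_le hD))⟩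

/-! ### The upper bound from private primes. -/

lemma s_add_card_filter (n : ℕ) :
    s n + (n.primeFactors.filter fun p => 1 < n.factorization p).card = numPrimes n := by
  rw [s, numPrimes, ← card_filter_add_card_filter_not (s := n.primeFactors)
    (fun p => n.factorization p = 1)]
  congr 2
  refine filter_congr fun p hp => ?_
  have : n.factorization p ≠ 0 := Finsupp.mem_support_iff.1 (by simpa using hp)
  omega

lemma r_add_s (n : ℕ) : r n + s n = 2 * numPrimes n := by
  have := s_add_card_filter n
  rw [r]
  omega

lemma mod_four_eq_two_iff {n : ℕ} (hn : n ≠ 0) (h2 : Even n) :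
    n % 4 = 2 ↔ n.factorization 2 = 1 := by
  have h1 := (Nat.prime_two.pow_dvd_iff_le_factorization (k := 1) hn)
  have h4 := (Nat.prime_two.pow_dvd_iff_le_factorization (k := 2) hn)
  rw [even_iff_two_dvd] at h2
  norm_num at h1 h4
  omega

lemma ediam_le_of_private {n : ℕ} [NeZero n] {D : Finset ℕ} (hD : D ⊆ n.properDivisors)
    (hcov : Covers n D)
    (hpriv : ∀ d ∈ D, ∃ p ∈ n.primeFactors, ¬ p ∣ d ∧ ∀ e ∈ D, e ≠ d → p ∣ e) :
    D.card ≤ numPrimes n ∧ (icg n D).ediam ≤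
      ((if n % 4 = 2 ∧ D.card ≠ numPrimes n then r n + 1 else r n : ℕ) : ℕ∞) := by
  choose! f hfP hf hfe using hpriv
  choose! g hgD hg using hcov
  have hinj : Set.InjOn f D := by
    intro d hd e he hde
    by_contra hne
    exact hf e he (hde ▸ hfe d hd e he (Ne.symm hne))
  have hQ : D.image f ⊆ n.primeFactors := image_subset_iff.2 hfP
  have hQc : (D.image f).card = D.card := card_image_of_injOn hinj
  set N := n.primeFactors \ D.image f with hN
  have hNc : N.card + D.card = numPrimes n := by
    rw [hN, ← hQc, numPrimes, card_sdiff_add_card_eq_card hQ]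
  set F := N.image g with hF
  have hFc : F.card ≤ N.card := card_image_le
  set A := D.filter fun d => n.factorization (f d) = 1 with hA
  set NS := N.filter fun p => n.factorization p = 1 with hNS
  have hAc : A.card + NS.card = s n := by
    have h1 : (A.image f).card = A.card :=
      card_image_of_injOn (hinj.mono (coe_subset.2 (filter_subset _ _)))
    rw [← h1, s, ← card_union_of_disjoint]
    · congr 1
      ext p
      simp only [hA, hNS, hN, mem_union, mem_image, mem_filter, mem_sdiff]
      constructor
      · rintro (⟨d, ⟨hd, hd1⟩, rfl⟩ | ⟨⟨hp, -⟩, h1⟩)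
        · exact ⟨hfP d hd, hd1⟩
        · exact ⟨hp, h1⟩
      · rintro ⟨hp, h1⟩
        by_cases h : ∃ d ∈ D, f d = p
        · obtain ⟨d, hd, rfl⟩ := h
          exact Or.inl ⟨d, ⟨hd, h1⟩, rfl⟩
        · exact Or.inr ⟨⟨hp, h⟩, h1⟩
    · rw [disjoint_left]
      intro p hp hp'
      obtain ⟨d, hd, rfl⟩ := mem_image.1 hp
      exact (mem_sdiff.1 (mem_filter.1 hp').1).2 (mem_image_of_mem f (mem_filter.1 hd).1)
  refine ⟨by omega, ediam_le_of_reaches hD _ fun x => ?_⟩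
  -- Divisors in `F` are used twice for the sake of `N`; any other needs only what its private prime
  -- demands.
  set u : ℕ → ℕ := fun d => if d ∈ F then 2 else if (f d : ℤ) ∣ x then
    (if n.factorization (f d) = 1 then 0 else 2) else 1 with hu
  have hcases : ∀ d, (u d = 2 ∧ (d ∈ F ∨ n.factorization (f d) ≠ 1)) ∨
      (((f d : ℤ) ∣ x) ∧ n.factorization (f d) = 1 ∧ u d = 0) ∨
      (¬ (f d : ℤ) ∣ x ∧ u d = 1) := by
    intro d
    by_cases h1 : d ∈ F
    · simp [hu, h1]
    by_cases h2 : (f d : ℤ) ∣ x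
    · by_cases h3 : n.factorization (f d) = 1 <;> simp [hu, h1, h2, h3]
    · simp [hu, h1, h2]
  have hr := r_add_s n
  have hNSc : NS.card ≤ N.card := card_filter_le _ _
  -- Every divisor in `A` outside `F` saves a step. As `A ∩ F` and `NS` have at most `N.card`
  -- elements each, the total is at most `2k - s = r`.
  have hsum : ∑ d ∈ D, u d + A.card ≤ 2 * D.card + (A ∩ F).card := by
    have h1 : A.card = ∑ d ∈ D, if n.factorization (f d) = 1 then 1 else 0 := by
      rw [hA, card_filter]
    have h2 : (A ∩ F).card = ∑ d ∈ D, if n.factorization (f d) = 1 ∧ d ∈ F then 1 else 0 := by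
      rw [← card_filter, filter_and, hA]
      congr 1
      ext d
      simp only [mem_inter, mem_filter]
      tauto
    rw [h1, h2, mul_comm, ← smul_eq_mul, ← sum_const, ← sum_add_distrib, ← sum_add_distrib]
    refine sum_le_sum fun d _ => ?_
    rcases hcases d with ⟨h, hd⟩ | ⟨-, h1, h0⟩ | ⟨-, h1⟩
    · rw [h]
      by_cases h1 : n.factorization (f d) = 1
      · rw [if_pos h1, if_pos ⟨h1, hd.resolve_right (not_not.2 h1)⟩]
      · rw [if_neg h1]
        omega
    · rw [h0, if_pos h1]
      omega
    · rw [h1]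
      split_ifs <;> omega
  have hAF : (A ∩ F).card ≤ F.card := card_le_card inter_subset_right
  have hodd : ∀ p ∈ n.primeFactors, p ≠ 2 → Reaches n D u x p := by
    intro p hp hp2
    by_cases hpN : p ∈ N
    · refine Or.inr (Or.inl ⟨hp2, g p, hgD p hp, hg p hp, ?_⟩)
      have : g p ∈ F := mem_image_of_mem g hpN
      simp [hu, this]
    · obtain ⟨d, hd, rfl⟩ : ∃ d ∈ D, f d = p := by
        by_contra h
        exact hpN (mem_sdiff.2 ⟨hp, fun h' => h (mem_image.1 h')⟩)
      rcases hcases d with ⟨h2, -⟩ | ⟨hx, h3, h0⟩ | ⟨hx, h1⟩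
      · exact Or.inr (Or.inl ⟨hp2, d, hd, hf d hd, h2.ge⟩)
      · exact Or.inl ⟨h3, hx, fun e he he0 => hfe d hd e he (by rintro rfl; exact he0 h0)⟩
      · exact Or.inr (Or.inr (Or.inl ⟨hx, d, hd, hf d hd, h1, fun e he hed _ => hfe d hd e he hed⟩))
  by_cases h2n : 2 ∈ n.primeFactors
  swap
  · refine ⟨u, fun p hp => hodd p hp (by rintro rfl; exact h2n hp), ?_⟩
    split_ifs <;> omega
  have h4 := mod_four_eq_two_iff (NeZero.ne n) ((two_mem_primeFactors (NeZero.ne n)).1 h2n)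
  -- The parity step costs one. If 4 divides `n`, then 2 is missing from `NS`, which pays for it.
  by_cases h2N : 2 ∈ N
  · have hF2 : g 2 ∈ F := mem_image_of_mem g h2N
    obtain ⟨u', hu', hs'⟩ := exists_reaches_of_odd hodd (hgD 2 h2n) (hg 2 h2n) (by simp [hu, hF2])
    refine ⟨u', hu', ?_⟩
    have hNpos : 0 < N.card := card_pos.2 ⟨2, h2N⟩
    by_cases h42 : n % 4 = 2
    · rw [if_pos ⟨h42, by omega⟩]
      omega
    · rw [if_neg (by tauto)]
      have : NS.card < N.card := by
        refine card_lt_card (filter_ssubset.2 ⟨2, h2N, fun h => h42 (h4.2 h)⟩)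
      omega
  obtain ⟨d, hd, hd2⟩ : ∃ d ∈ D, f d = 2 := by
    by_contra h
    exact h2N (mem_sdiff.2 ⟨h2n, fun h' => h (mem_image.1 h')⟩)
  by_cases hdF : d ∈ F
  · obtain ⟨u', hu', hs'⟩ := exists_reaches_of_odd hodd hd (hd2 ▸ hf d hd) (by simp [hu, hdF])
    refine ⟨u', hu', ?_⟩
    have hFpos : 0 < F.card := card_pos.2 ⟨d, hdF⟩
    by_cases h42 : n % 4 = 2
    · rw [if_pos ⟨h42, by omega⟩]
      omega
    · rw [if_neg (by tauto)]
      -- Here `d` lies in `F` but not in `A`, which pays for the parity step.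
      have : (A ∩ F).card < F.card := by
        refine card_lt_card (ssubset_iff_of_subset inter_subset_right |>.2 ⟨d, hdF, fun h => ?_⟩)
        have := (mem_filter.1 (mem_inter.1 h).1).2
        rw [hd2] at this
        exact h42 (h4.2 this)
      omega
  -- With `d` outside `F`, the counts already have the right parity: all other divisors are even and
  -- `u d` was chosen from `x`.
  refine ⟨u, fun p hp => ?_, by split_ifs <;> omega⟩
  rcases eq_or_ne p 2 with rfl | hp2
  swap
  · exact hodd p hp hp2
  by_cases hx : (2 : ℤ) ∣ x
  · by_cases h1 : n.factorization 2 = 1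
    · refine Or.inl ⟨h1, hx, fun e he he0 => ?_⟩
      rw [← hd2]
      refine hfe d hd e he ?_
      rintro rfl
      simp [hu, hdF, hd2, hx, h1] at he0
    · have hud : u d = 2 := by simp [hu, hdF, hd2, hx, h1]
      refine Or.inr (Or.inr (Or.inr ⟨rfl, ⟨d, hd, hd2 ▸ hf d hd, by simp [hud]⟩, ?_⟩))
      refine dvd_sub (dvd_sum fun e he => ?_) hx
      rcases eq_or_ne e d with rfl | hed
      · rw [hud]
        exact Dvd.intro _ rfl
      · have := hfe d hd e he hed
        rw [hd2] at this
        exact (Int.natCast_dvd_natCast.2 this).trans (dvd_mul_left _ _)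
  · refine Or.inr (Or.inr (Or.inl ⟨by exact_mod_cast hx, d, hd, hd2 ▸ hf d hd, ?_,
      fun e he hed _ => hd2 ▸ hfe d hd e he hed⟩))
    simp [hu, hdF, hd2, hx]

/-! ### Lower bounds from the uses forced on a walk. -/

/-- Here `c d` counts the steps of gcd `d`. When all other divisors vanish modulo `p ^ i`, only the
steps counted by `c d` affect the displacement there. -/
lemma exists_counts_of_walk {n : ℕ} [NeZero n] {D : Finset ℕ} {a b : ZMod n}
    (w : (icg n D).Walk a b) : ∃ (c : ℕ → ℕ) (z : ℤ), (z : ZMod n) = b - a ∧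
      ∑ d ∈ D, c d = w.length ∧ ∀ d ∈ D, ∀ p i : ℕ, p.Prime → i ≠ 0 → p ^ i ∣ n → ¬ p ∣ d →
        (∀ e ∈ D, e ≠ d → p ^ i ∣ e) → (c d = 0 → ((p ^ i : ℕ) : ℤ) ∣ z) ∧
          (c d = 1 → ¬ (p : ℤ) ∣ z) ∧ (p = 2 → ((2 : ℤ) ∣ z ↔ Even (c d))) := by
  induction w with
  | nil => exact ⟨fun _ => 0, 0, by simp⟩
  | @cons a v b hadj w ih =>
    obtain ⟨c, z, hz, hc, h⟩ := ih
    obtain ⟨y, hy, hyD⟩ := exists_intCast_eq_sub_of_adj hadj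
    set e := Int.gcd y n with he
    refine ⟨Function.update c e (c e + 1), y + z, by push_cast; rw [hy, hz]; ring, ?_, ?_⟩
    · have := sum_update_add_one c hyD fun _ => (1 : ℕ)
      simp only [Nat.cast_id, mul_one] at this
      rw [this, hc, SimpleGraph.Walk.length_cons]
    · intro d hd p i hp hi hpn hpd hpe
      obtain ⟨h0, h1, h2⟩ := h d hd p i hp hi hpn hpd hpe
      rcases eq_or_ne e d with hed | hed
      · have hpy : ¬ (p : ℤ) ∣ y := fun hpy => hpd <| by
          rw [← hed, he]
          exact Int.dvd_gcd hpy (Int.natCast_dvd_natCast.2 ((dvd_pow_self p hi).trans hpn))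
        rw [← hed, Function.update_self, hed]
        refine ⟨fun h => absurd h (Nat.succ_ne_zero _), fun hc1 hpz => hpy ?_, ?_⟩
        · have := h0 (by omega)
          exact (dvd_add_left ((Int.natCast_dvd_natCast.2 (dvd_pow_self p hi)).trans this)).1 hpz
        · rintro rfl
          have := h2 rfl
          rw [Nat.even_add_one, ← this]
          push_cast at hpy
          omega
      · rw [Function.update_of_ne (Ne.symm hed)]
        have hpy : ((p ^ i : ℕ) : ℤ) ∣ y :=
          (Int.natCast_dvd_natCast.2 (hpe e hyD hed)).trans (he ▸ Int.gcd_dvd_left _ _)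
        have hpy' : (p : ℤ) ∣ y := (Int.natCast_dvd_natCast.2 (dvd_pow_self p hi)).trans hpy
        refine ⟨fun hc => (dvd_add_right hpy).2 (h0 hc),
          fun hc => (dvd_add_right hpy').not.2 (h1 hc), ?_⟩
        rintro rfl
        rw [← h2 rfl]
        exact dvd_add_right hpy'

/-- The product of the prime powers of `n` whose prime is not sent to `q` by `ρ`. -/
def coprimePart (n : ℕ) (ρ : ℕ → ℕ) (q : ℕ) : ℕ :=
  ∏ p ∈ n.primeFactors.filter fun p => ρ p ≠ q, p ^ n.factorization p

lemma pow_dvd_coprimePart {n p q : ℕ} {ρ : ℕ → ℕ} (hp : p ∈ n.primeFactors) (h : ρ p ≠ q) :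
    p ^ n.factorization p ∣ coprimePart n ρ q :=
  dvd_prod_of_mem (fun p => p ^ n.factorization p) (mem_filter.2 ⟨hp, h⟩)

lemma not_dvd_coprimePart {n p q : ℕ} {ρ : ℕ → ℕ} (hp : p ∈ n.primeFactors) (h : ρ p = q) :
    ¬ p ∣ coprimePart n ρ q := by
  have hp' := Nat.prime_of_mem_primeFactors hp
  intro hd
  obtain ⟨l, hl, hpl⟩ := (hp'.prime.dvd_finsetProd_iff _).1 hd
  obtain ⟨hl1, hl2⟩ := mem_filter.1 hl
  have := (Nat.prime_dvd_prime_iff_eq hp' (Nat.prime_of_mem_primeFactors hl1)).1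
    (hp'.dvd_of_dvd_pow hpl)
  exact hl2 (this ▸ h)

lemma coprimePart_dvd {n : ℕ} (hn : n ≠ 0) (ρ : ℕ → ℕ) (q : ℕ) : coprimePart n ρ q ∣ n := by
  conv_rhs => rw [← Nat.prod_factorization_pow_eq_self hn]
  exact prod_dvd_prod_of_subset _ _ _ (filter_subset _ _)

/-- Lower bound for graphs whose divisors come from a partition of the prime factors of `n`. -/
lemma exists_isIrredundant_le_diam {n : ℕ} [NeZero n] (R : Finset ℕ) (hR : R ⊆ n.primeFactors)
    (ρ : ℕ → ℕ) (hρ : ∀ p ∈ n.primeFactors, ρ p ∈ R) (hρR : ∀ q ∈ R, ρ q = q) (x : ℤ) (w : ℕ → ℕ)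
    (hw : ∀ q ∈ R, ∀ c : ℕ, (∀ p ∈ n.primeFactors, ρ p = q →
      (c = 0 → ((p ^ n.factorization p : ℕ) : ℤ) ∣ x) ∧ (c = 1 → ¬ (p : ℤ) ∣ x) ∧
        (p = 2 → ((2 : ℤ) ∣ x ↔ Even c))) → w q ≤ c) :
    ∃ D : Finset ℕ, IsIrredundant n D ∧ D.card = R.card ∧ ∑ q ∈ R, w q ≤ (icg n D).diam := by
  have hn := NeZero.ne n
  have hfac : ∀ p ∈ n.primeFactors, n.factorization p ≠ 0 := fun p hp =>
    Finsupp.mem_support_iff.1 (by simpa using hp)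
  have hother : ∀ q ∈ R, ∀ q' ∈ R, q' ≠ q → q ∣ coprimePart n ρ q' := fun q hq q' hq' hne =>
    (dvd_pow_self q (hfac q (hR hq))).trans
      (pow_dvd_coprimePart (hR hq) (by rw [hρR q hq]; exact hne.symm))
  have hself : ∀ q ∈ R, ¬ q ∣ coprimePart n ρ q := fun q hq =>
    not_dvd_coprimePart (hR hq) (hρR q hq)
  have hinj : Set.InjOn (coprimePart n ρ) R := by
    intro q hq q' hq' h
    by_contra hne
    exact hself q hq (h ▸ hother q hq q' hq' (Ne.symm hne))
  have hD : R.image (coprimePart n ρ) ⊆ n.properDivisors := by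
    intro d hd
    obtain ⟨q, hq, rfl⟩ := mem_image.1 hd
    have hdvd := coprimePart_dvd hn ρ q
    refine Nat.mem_properDivisors.2
      ⟨hdvd, lt_of_le_of_ne (Nat.le_of_dvd (Nat.pos_of_ne_zero hn) hdvd) fun h => ?_⟩
    exact hself q hq (h.symm ▸ Nat.dvd_of_mem_primeFactors (hR hq))
  have hconn : IsConnectedDivisorSet n (R.image (coprimePart n ρ)) := by
    refine Covers.connected hD fun p hp => ?_
    exact ⟨_, mem_image_of_mem _ (hρ p hp), not_dvd_coprimePart hp rfl⟩
  refine ⟨_, ⟨hconn, ?_⟩, card_image_of_injOn hinj, ?_⟩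
  · intro d hd
    obtain ⟨q, hq, rfl⟩ := mem_image.1 hd
    refine ⟨q, hR hq, hself q hq, fun e he hne => ?_⟩
    obtain ⟨q', hq', rfl⟩ := mem_image.1 he
    exact hother q hq q' hq' (by rintro rfl; exact hne rfl)
  -- On a geodesic from 0 to `x`, each count is at least `w q`.
  obtain ⟨v, hv⟩ := hconn.2.exists_walk_length_eq_dist 0 (x : ZMod n)
  obtain ⟨c, z, hz, hc, h⟩ := exists_counts_of_walk v
  refine le_trans ?_ (SimpleGraph.dist_le_diam
    (SimpleGraph.connected_iff_ediam_ne_top.1 hconn.2) (u := 0) (v := (x : ZMod n)))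
  rw [← hv, ← hc, sum_image hinj]
  refine sum_le_sum fun q hq => hw q hq _ fun p hp hpq => ?_
  have hp' := Nat.prime_of_mem_primeFactors hp
  have hpn : p ^ n.factorization p ∣ n := Nat.ordProj_dvd n p
  have hzx : (n : ℤ) ∣ z - x := by
    rw [← ZMod.intCast_zmod_eq_zero_iff_dvd, Int.cast_sub, hz]
    ring
  have hpzx := (Int.natCast_dvd_natCast.2 hpn).trans hzx
  have hpzx' := (Int.natCast_dvd_natCast.2 (Nat.dvd_of_mem_primeFactors hp)).trans hzx
  obtain ⟨h0, h1, h2⟩ := h _ (mem_image_of_mem _ hq) p _ hp' (hfac p hp) hpn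
    (not_dvd_coprimePart hp hpq) (by
      intro e he hne
      obtain ⟨q', hq', rfl⟩ := mem_image.1 he
      exact pow_dvd_coprimePart hp (by rintro h3; exact hne (by rw [← hpq, ← h3])))
  refine ⟨fun hc => (dvd_iff_dvd_of_dvd_sub hpzx).1 (h0 hc),
    fun hc => (dvd_iff_dvd_of_dvd_sub hpzx').not.1 (h1 hc), ?_⟩
  rintro rfl
  rw [← h2 rfl]
  exact (dvd_iff_dvd_of_dvd_sub hpzx').symm

lemma prime_dvd_prod_primes_iff {B : Finset ℕ} (hB : ∀ p ∈ B, p.Prime) {p : ℕ} (hp : p.Prime) :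
    p ∣ ∏ q ∈ B, q ↔ p ∈ B := by
  rw [hp.prime.dvd_finsetProd_iff]
  refine ⟨fun ⟨q, hq, hpq⟩ => ?_, fun h => ⟨p, h, dvd_rfl⟩⟩
  rwa [(Nat.prime_dvd_prime_iff_eq hp (hB q hq)).1 hpq]

lemma not_pow_dvd_prod_primes {B : Finset ℕ} (hB : ∀ p ∈ B, p.Prime) {p i : ℕ} (hp : p.Prime)
    (hi : 1 < i) : ¬ p ^ i ∣ ∏ q ∈ B, q := by
  intro h
  have h2 : p * p ∣ ∏ q ∈ B, q := by
    rw [← sq]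
    exact (pow_dvd_pow p hi).trans h
  have hpB := (prime_dvd_prod_primes_iff hB hp).1 ((dvd_mul_right p p).trans h2)
  rw [← mul_prod_erase _ _ hpB] at h2
  have h3 := (prime_dvd_prod_primes_iff (fun q hq => hB q (mem_of_mem_erase hq)) hp).1
    (Nat.dvd_of_mul_dvd_mul_left hp.pos h2)
  simp at h3

/-- Lower bound with the target vertex a product of distinct primes. -/
lemma exists_isIrredundant_le_diam_of_primes {n : ℕ} [NeZero n] (R : Finset ℕ)
    (hR : R ⊆ n.primeFactors) (ρ : ℕ → ℕ) (hρ : ∀ p ∈ n.primeFactors, ρ p ∈ R)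
    (hρR : ∀ q ∈ R, ρ q = q) (B : Finset ℕ) (hB : B ⊆ n.primeFactors) (w : ℕ → ℕ)
    (hw : ∀ q ∈ R, w q ≤ 1 ∧ q ∉ B ∨ w q ≤ 2 ∧ q ∈ B ∧ 1 < n.factorization q ∨
      (∃ p ∈ B, ρ p = q) ∧ q ∉ B ∧ w q ≤ if q = 2 then 3 else 2) :
    ∃ D : Finset ℕ, IsIrredundant n D ∧ D.card = R.card ∧ ∑ q ∈ R, w q ≤ (icg n D).diam := by
  have hBp : ∀ p ∈ B, p.Prime := fun p hp => Nat.prime_of_mem_primeFactors (hB hp)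
  refine exists_isIrredundant_le_diam R hR ρ hρ hρR ((∏ p ∈ B, p : ℕ) : ℤ) w fun q hq c hc => ?_
  have hqp := Nat.prime_of_mem_primeFactors (hR hq)
  have hfac : n.factorization q ≠ 0 := Finsupp.mem_support_iff.1 (by simpa using hR hq)
  simp only [Int.natCast_dvd_natCast] at hc
  obtain ⟨h0, h1, h2⟩ := hc q (hR hq) (hρR q hq)
  have hc0 : q ∉ B → c ≠ 0 := fun hqB hc0 => hqB <|
    (prime_dvd_prod_primes_iff hBp hqp).1 ((dvd_pow_self q hfac).trans (h0 hc0))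
  -- The target is squarefree. A prime `q` outside `B` rules out zero uses, `q` in `B` of exponent
  -- above one rules out zero and one, and a second prime of the class in `B` rules out one; for `q
  -- = 2` outside `B` the count is odd, hence 3.
  rcases hw q hq with ⟨hw, hqB⟩ | ⟨hw, hqB, hf⟩ | ⟨⟨p, hpB, hpq⟩, hqB, hw⟩
  · have := hc0 hqB
    omega
  · have h3 : c ≠ 0 := fun hc0 => not_pow_dvd_prod_primes hBp hqp hf (h0 hc0)
    have h4 : c ≠ 1 := fun hc1 => h1 hc1 ((prime_dvd_prod_primes_iff hBp hqp).2 hqB)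
    omega
  · have h3 := hc0 hqB
    have h4 : c ≠ 1 := fun hc1 => (hc p (hB hpB) hpq).2.1 hc1
      ((prime_dvd_prod_primes_iff hBp (hBp p hpB)).2 hpB)
    split_ifs at hw with hq2
    · subst hq2
      have h5 : ¬ Even c := fun he => hqB <|
        (prime_dvd_prod_primes_iff hBp hqp).1 (Int.natCast_dvd_natCast.1 ((h2 rfl).2 he))
      have h6 : c ≠ 2 := by
        rintro rfl
        exact h5 even_two
      omega
    · omega

/-! ### Extremal divisor sets. -/

lemma exists_isIrredundant_card_eq_numPrimes {n : ℕ} [NeZero n] :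
    ∃ D : Finset ℕ, IsIrredundant n D ∧ D.card = numPrimes n ∧ r n ≤ (icg n D).diam := by
  obtain ⟨D, hD, hc, hd⟩ := exists_isIrredundant_le_diam_of_primes n.primeFactors Subset.rfl id
    (fun _ h => h) (fun _ _ => rfl) (n.primeFactors.filter fun p => 1 < n.factorization p)
    (filter_subset _ _) (fun p => 1 + if 1 < n.factorization p then 1 else 0) (fun q hq => by
      by_cases h : 1 < n.factorization q
      · exact Or.inr (Or.inl ⟨by simp [h], mem_filter.2 ⟨hq, h⟩, h⟩)
      · exact Or.inl ⟨by simp [h], fun h' => h (mem_filter.1 h').2⟩)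
  refine ⟨D, hD, hc, le_of_eq_of_le ?_ hd⟩
  rw [sum_add_distrib, ← card_filter, r, numPrimes]
  simp

lemma exists_isIrredundant_card_lt {n t : ℕ} [NeZero n] (ht : 1 ≤ t) (htk : t < numPrimes n) :
    ∃ D : Finset ℕ, IsIrredundant n D ∧ D.card = t ∧ maxDiamValue n t ≤ (icg n D).diam := by
  set P := n.primeFactors with hP
  have hPk : P.card = numPrimes n := rfl
  set S := P.filter fun p => n.factorization p = 1 with hS
  have hSs : S.card = s n := rfl
  have hSP : S ⊆ P := filter_subset _ _
  have hS' : S.erase 2 ⊆ P.erase 2 := erase_subset_erase _ hSP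
  have hPe : P.card - 1 ≤ (P.erase 2).card := pred_card_le_card_erase
  -- `M` holds the odd primes that do not represent their class, with exponent-one primes chosen
  -- first since they would force only one use.
  obtain ⟨M, hMP, hMc, hMS⟩ : ∃ M ⊆ P.erase 2, M.card = numPrimes n - t ∧
      (M ⊆ S.erase 2 ∨ S.erase 2 ⊆ M ∧ (S.erase 2).card < M.card) := by
    rcases le_or_gt (numPrimes n - t) (S.erase 2).card with h | h
    · obtain ⟨M, hM, hc⟩ := exists_subset_card_eq h
      exact ⟨M, hM.trans hS', hc, Or.inl hM⟩
    · obtain ⟨M, hM, hM', hc⟩ := exists_subsuperset_card_eq hS' h.le (by omega)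
      exact ⟨M, hM', hc, Or.inr ⟨hM, hc ▸ h⟩⟩
  have hMP' : M ⊆ P := hMP.trans (erase_subset _ _)
  have hM2 : 2 ∉ M := fun h => notMem_erase 2 P (hMP h)
  set R := P \ M with hR
  have hRc : R.card + M.card = P.card := card_sdiff_add_card_eq_card hMP'
  -- Representatives that profit from a partner in `M`: from 1 use to 2, or to 3 for the prime 2.
  -- `Z'` is the set that gets one, including 2 when `n` is even.
  set Z := R.filter fun q => n.factorization q = 1 ∨ q = 2 with hZ
  have hZR : Z ⊆ R := filter_subset _ _
  have h2Z : 2 ∈ P → 2 ∈ Z := fun h => mem_filter.2 ⟨mem_sdiff.2 ⟨h, hM2⟩, Or.inr rfl⟩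
  obtain ⟨Z', hZ'2, hZ'Z, hZ'c⟩ : ∃ Z' : Finset ℕ, Z.filter (· = 2) ⊆ Z' ∧ Z' ⊆ Z ∧
      Z'.card = min M.card Z.card := by
    refine exists_subsuperset_card_eq (filter_subset _ _) (le_min ?_ ?_) (min_le_right _ _)
    · refine le_trans (card_le_one.2 ?_) (by omega : 1 ≤ M.card)
      intro a ha b hb
      rw [(mem_filter.1 ha).2, (mem_filter.1 hb).2]
    · exact card_le_card (filter_subset _ _)
  have h2Z' : 2 ∈ P → 2 ∈ Z' := fun h => hZ'2 (mem_filter.2 ⟨h2Z h, rfl⟩)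
  obtain ⟨g⟩ : Nonempty (Z' ↪ M) := Function.Embedding.nonempty_of_card_le
    (by rw [Fintype.card_coe, Fintype.card_coe, hZ'c]; exact min_le_left _ _)
  obtain ⟨q₀, hq₀⟩ : R.Nonempty := card_pos.1 (by omega)
  classical
  -- Primes of `M` that partner nobody join the class of an arbitrary `q₀`.
  set ρ : ℕ → ℕ := fun p => if p ∈ R then p else
    if h : ∃ z : Z', (g z : ℕ) = p then (h.choose : ℕ) else q₀ with hρ
  have hρR : ∀ q ∈ R, ρ q = q := fun q hq => by simp only [hρ, if_pos hq]
  have hρP : ∀ p ∈ P, ρ p ∈ R := by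
    intro p _
    simp only [hρ]
    split_ifs with h1 h2
    · exact h1
    · exact hZR (hZ'Z h2.choose.2)
    · exact hq₀
  have hρg : ∀ z : Z', ρ (g z) = z := by
    intro z
    have h1 : (g z : ℕ) ∉ R := fun h => (mem_sdiff.1 h).2 (g z).2
    have h2 : ∃ z' : Z', (g z' : ℕ) = g z := ⟨z, rfl⟩
    simp only [hρ, if_neg h1, dif_pos h2]
    rw [g.injective (Subtype.ext h2.choose_spec)]
  set w : ℕ → ℕ := fun q => if q ∈ Z \ Z' then 1 else if q = 2 then 3 else 2 with hw
  have hfac : ∀ p ∈ P, n.factorization p ≠ 0 := fun p hp =>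
    Finsupp.mem_support_iff.1 (by simpa [hP] using hp)
  obtain ⟨D, hD, hDc, hd⟩ := exists_isIrredundant_le_diam_of_primes R sdiff_subset ρ hρP hρR
    (P.filter fun p => p ≠ 2 ∧ (p ∈ M ∨ 1 < n.factorization p)) (filter_subset _ _) w (by
      intro q hq
      have hqP := (mem_sdiff.1 hq).1
      have hqM := (mem_sdiff.1 hq).2
      have hZB : q ∈ Z → q ∉ P.filter fun p => p ≠ 2 ∧ (p ∈ M ∨ 1 < n.factorization p) := by
        intro h h'
        have h1 := (mem_filter.1 h).2
        have h2 := (mem_filter.1 h').2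
        rcases h1 with h1 | h1
        · rcases h2.2 with h3 | h3
          · exact hqM h3
          · omega
        · exact h2.1 h1
      by_cases h1 : q ∈ Z \ Z'
      · exact Or.inl ⟨by simp only [hw, if_pos h1, le_refl], hZB (mem_sdiff.1 h1).1⟩
      by_cases h2 : q ∈ Z
      · have h3 : q ∈ Z' := by
          by_contra h
          exact h1 (mem_sdiff.2 ⟨h2, h⟩)
        refine Or.inr (Or.inr ⟨⟨g ⟨q, h3⟩, ?_, hρg ⟨q, h3⟩⟩, hZB h2,
          by simp only [hw, if_neg h1, le_refl]⟩)
        have hg := (g ⟨q, h3⟩).2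
        exact mem_filter.2 ⟨hMP' hg, fun h => hM2 (h ▸ hg), Or.inl hg⟩
      · have h3 : ¬ (n.factorization q = 1 ∨ q = 2) := fun h => h2 (mem_filter.2 ⟨hq, h⟩)
        have h4 := hfac q hqP
        push Not at h3
        have h5 : 1 < n.factorization q := by omega
        refine Or.inr (Or.inl ⟨?_, mem_filter.2 ⟨hqP, h3.2, Or.inr h5⟩, h5⟩)
        simp only [hw, if_neg h1, if_neg h3.2, le_refl])
  refine ⟨D, hD, by omega, le_trans ?_ hd⟩
  have hsum : ∑ q ∈ R, w q + (Z \ Z').card = 2 * R.card + if 2 ∈ P then 1 else 0 := by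
    have h1 : (Z \ Z').card = ∑ q ∈ R, if q ∈ Z \ Z' then 1 else 0 := by
      rw [← card_filter, filter_mem_eq_inter, inter_eq_right.2 (sdiff_subset.trans hZR)]
    have h2 : (if 2 ∈ P then 1 else 0) = ∑ q ∈ R, if q = 2 then 1 else 0 := by
      rw [sum_ite_eq']
      simp only [hR, mem_sdiff, hM2, not_false_eq_true, and_true]
    rw [h1, h2, mul_comm, ← smul_eq_mul, ← sum_const, ← sum_add_distrib, ← sum_add_distrib]
    refine sum_congr rfl fun q hq => ?_
    simp only [hw]
    by_cases h3 : q ∈ Z \ Z'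
    · have h4 : q ≠ 2 := by
        rintro rfl
        exact (mem_sdiff.1 h3).2 (h2Z' (mem_sdiff.1 hq).1)
      rw [if_pos h3, if_pos h3, if_neg h4]
    · rw [if_neg h3, if_neg h3]
      split_ifs <;> rfl
  have hZZ' : (Z \ Z').card + Z'.card = Z.card := card_sdiff_add_card_eq_card hZ'Z
  have hZc1 : M ⊆ S.erase 2 → Z.card + M.card = (S.erase 2).card + if 2 ∈ P then 1 else 0 := by
    intro hMS
    have h1 : (S.erase 2 \ M).card + M.card = (S.erase 2).card := card_sdiff_add_card_eq_card hMS
    have h2 : Z.erase 2 = S.erase 2 \ M := by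
      ext q
      simp only [hZ, hR, hS, mem_erase, mem_filter, mem_sdiff]
      tauto
    split_ifs with h
    · have := card_erase_add_one (h2Z h)
      rw [h2] at this
      omega
    · rw [erase_eq_of_notMem (fun h' => h (mem_sdiff.1 (hZR h')).1)] at h2
      rw [h2]
      omega
  have hZc2 : S.erase 2 ⊆ M → Z.card ≤ 1 := by
    intro hMS
    refine card_le_one.2 ?_
    have : ∀ a ∈ Z, a = 2 := by
      intro a ha
      obtain ⟨haR, h1⟩ := mem_filter.1 ha
      obtain ⟨haP, haM⟩ := mem_sdiff.1 haR
      by_contra h2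
      exact haM (hMS (mem_erase.2 ⟨h2, mem_filter.2 ⟨haP, h1.resolve_right h2⟩⟩))
    intro a ha b hb
    rw [this a ha, this b hb]
  have hSe : (S.erase 2).card + (if n % 4 = 2 then 1 else 0) = s n := by
    split_ifs with h
    · have h2 : Even n := Nat.even_iff.2 (by omega)
      rw [← hSs]
      refine card_erase_add_one (mem_filter.2 ⟨(two_mem_primeFactors (NeZero.ne n)).2 h2, ?_⟩)
      exact (mod_four_eq_two_iff (NeZero.ne n) h2).1 h
    · rw [← hSs, erase_eq_of_notMem, add_zero]
      intro h2
      obtain ⟨h3, h4⟩ := mem_filter.1 h2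
      exact h ((mod_four_eq_two_iff (NeZero.ne n)
        ((two_mem_primeFactors (NeZero.ne n)).1 h3)).2 h4)
  have hr := r_add_s n
  have hev : n % 4 = 2 → Even n := fun h => Nat.even_iff.2 (by omega)
  simp only [hP, two_mem_primeFactors (NeZero.ne n)] at hsum hZc1
  rw [maxDiamValue]
  clear_value Z R S P w
  -- If `M` has only exponent-one primes, the loss `(Z \ Z').card` decides between the two bounds;
  -- otherwise `Z` has at most one element and nothing is lost.
  rcases hMS with hMS | ⟨hMS, hMS'⟩
  · have h1 := hZc1 hMS
    split_ifs at * <;> first | omega | tauto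
  · have h1 := hZc2 hMS
    split_ifs at * <;> omega

/-! ### Comparison with the formula and reduction to irredundant sets. -/

lemma IsIrredundant.card_le_and_diam_le {n : ℕ} [NeZero n] {D : Finset ℕ}
    (h : IsIrredundant n D) :
    D.card ≤ numPrimes n ∧ (icg n D).ediam ≤ (maxDiamValue n D.card : ℕ∞) := by
  have hcov := h.1.covers
  obtain ⟨hk, h1⟩ := ediam_le_of_private h.1.1 hcov h.2
  refine ⟨hk, ?_⟩
  have h2 := hcov.ediam_le h.1.1
  rw [maxDiamValue]
  by_cases ht : D.card = numPrimes n
  · rw [if_pos ht]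
    rwa [if_neg (by tauto)] at h1
  rw [if_neg ht]
  simp only [ne_eq, ht, not_false_eq_true, and_true] at h1
  split_ifs at * <;> assumption

lemma exists_isIrredundant {n t : ℕ} [NeZero n] (ht : 1 ≤ t) (htk : t ≤ numPrimes n) :
    ∃ D : Finset ℕ, IsIrredundant n D ∧ D.card = t ∧ (icg n D).diam = maxDiamValue n t := by
  obtain ⟨D, hD, hc, hd⟩ : ∃ D : Finset ℕ, IsIrredundant n D ∧ D.card = t ∧
      maxDiamValue n t ≤ (icg n D).diam := by
    rcases htk.eq_or_lt with rfl | h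
    · obtain ⟨D, hD, hc, hd⟩ := exists_isIrredundant_card_eq_numPrimes (n := n)
      exact ⟨D, hD, hc, by rwa [maxDiamValue, if_pos rfl]⟩
    · exact exists_isIrredundant_card_lt ht h
  refine ⟨D, hD, hc, le_antisymm ?_ hd⟩
  rw [← hc]
  exact ENat.toNat_le_of_le_natCast hD.card_le_and_diam_le.2

/-- In a minimal cover, the prime left uncovered by removing `d` is private to `d`. -/
lemma Covers.exists_subset_isIrredundant {n : ℕ} [NeZero n] {D : Finset ℕ}
    (hD : D ⊆ n.properDivisors) (h : Covers n D) : ∃ D' ⊆ D, IsIrredundant n D' := by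
  induction hm : D.card using Nat.strong_induction_on generalizing D with
  | _ m ih =>
    subst hm
    by_cases hmin : ∃ d ∈ D, Covers n (D.erase d)
    · obtain ⟨d, hd, hcov⟩ := hmin
      obtain ⟨D', hD', hirr⟩ := ih _ (card_erase_lt_of_mem hd) ((erase_subset _ _).trans hD)
        hcov rfl
      exact ⟨D', hD'.trans (erase_subset _ _), hirr⟩
    · refine ⟨D, Subset.rfl, h.connected hD, fun d hd => ?_⟩
      have h1 : ¬ Covers n (D.erase d) := fun h => hmin ⟨d, hd, h⟩
      simp only [Covers, not_forall, not_exists, not_and, not_not] at h1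
      obtain ⟨p, hp, hpe⟩ := h1
      obtain ⟨e, he, hpe'⟩ := h p hp
      have hed : e = d := by
        by_contra hne
        exact hpe' (hpe e (mem_erase.2 ⟨hne, he⟩))
      exact ⟨p, hp, hed ▸ hpe', fun f hf hfd => hpe f (mem_erase.2 ⟨hfd, hf⟩)⟩

lemma icg_mono (n : ℕ) {D D' : Finset ℕ} (h : D' ⊆ D) : icg n D' ≤ icg n D := by
  intro a b hab
  rw [icg, SimpleGraph.circulantGraph_adj] at hab ⊢
  refine ⟨hab.1, hab.2.imp ?_ ?_⟩ <;> exact fun ⟨d, hd, he⟩ => ⟨d, h hd, he⟩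

lemma IsConnectedDivisorSet.exists_diam_le {n : ℕ} [NeZero n] (hn : 2 ≤ n) {D : Finset ℕ}
    (h : IsConnectedDivisorSet n D) : ∃ t, 1 ≤ t ∧ t ≤ D.card ∧ t ≤ numPrimes n ∧
      (icg n D).diam ≤ maxDiamValue n t := by
  obtain ⟨D', hD', hirr⟩ := h.covers.exists_subset_isIrredundant h.1
  obtain ⟨hk, hd⟩ := hirr.card_le_and_diam_le
  refine ⟨D'.card, card_pos.2 ?_, card_le_card hD', hk, ?_⟩
  · obtain ⟨p, hp⟩ := Nat.nonempty_primeFactors.2 hn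
    obtain ⟨d, hd, -⟩ := hirr.1.covers p hp
    exact ⟨d, hd⟩
  · exact ENat.toNat_le_of_le_natCast ((SimpleGraph.ediam_anti (icg_mono n hD')).trans hd)

lemma s_le_numPrimes (n : ℕ) : s n ≤ numPrimes n := card_filter_le _ _

lemma one_le_s_of_mod_four {n : ℕ} (h : n % 4 = 2) : 1 ≤ s n := by
  have hn : n ≠ 0 := by omega
  have h2 : Even n := Nat.even_iff.2 (by omega)
  exact card_pos.2 ⟨2, mem_filter.2 ⟨(two_mem_primeFactors hn).2 h2,
    (mod_four_eq_two_iff hn h2).1 h⟩⟩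

/-- The side condition is needed: for `n ≡ 2 (mod 4)` with `s n ≥ 2` the value drops from `r n + 1`
to `r n` at `t = k`. -/
lemma maxDiamValue_mono {n t t' : ℕ} (htt : t' ≤ t) (htk : t ≤ numPrimes n)
    (h : t < numPrimes n ∨ n % 4 ≠ 2) : maxDiamValue n t' ≤ maxDiamValue n t := by
  have hr := r_add_s n
  have hs := s_le_numPrimes n
  have hs2 := one_le_s_of_mod_four (n := n)
  simp only [maxDiamValue, Nat.even_iff]
  split_ifs <;> omega

lemma maxDiamValue_le_overallMaxValue {n t : ℕ} (htk : t ≤ numPrimes n) :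
    maxDiamValue n t ≤ overallMaxValue n := by
  have hr := r_add_s n
  have hs := s_le_numPrimes n
  have hs2 := one_le_s_of_mod_four (n := n)
  simp only [maxDiamValue, overallMaxValue, Nat.even_iff]
  split_ifs <;> omega

lemma exists_maxDiamValue_eq_overallMaxValue {n : ℕ} (hn : 2 ≤ n) :
    ∃ t, 1 ≤ t ∧ t ≤ numPrimes n ∧ maxDiamValue n t = overallMaxValue n := by
  have hs := s_le_numPrimes n
  have hk : 0 < numPrimes n := card_pos.2 (Nat.nonempty_primeFactors.2 hn)
  by_cases h : n % 4 = 2 ∧ 2 ≤ s n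
  -- `s n ≥ 2` puts `k - 1` in the range where the value is `r n + 1`.
  · refine ⟨numPrimes n - 1, by omega, by omega, ?_⟩
    rw [maxDiamValue, overallMaxValue, if_pos h, if_neg (by omega), if_pos h.2,
      if_pos (by omega), if_pos h.1]
  · exact ⟨numPrimes n, hk, le_rfl, by rw [maxDiamValue, overallMaxValue, if_neg h, if_pos rfl]⟩

end IntegralCirculant

theorem mainTheorem6 (n : ℕ) (hn : 2 ≤ n) :
    -- the formula, for divisor sets with private primes
    (∀ t : ℕ, 1 ≤ t → t ≤ IntegralCirculant.numPrimes n →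
      IsGreatest {m : ℕ | ∃ D : Finset ℕ, IntegralCirculant.IsIrredundant n D ∧ D.card = t ∧
          (IntegralCirculant.icg n D).diam = m}
        (IntegralCirculant.maxDiamValue n t)) ∧
    -- the formula, for all connected graphs
    (∀ t : ℕ, 1 ≤ t → t ≤ IntegralCirculant.numPrimes n →
      (t < IntegralCirculant.numPrimes n ∨ n % 4 ≠ 2) →
      IsGreatest {m : ℕ | ∃ D : Finset ℕ, IntegralCirculant.IsConnectedDivisorSet n D ∧
          D.card = t ∧ (IntegralCirculant.icg n D).diam = m}
        (IntegralCirculant.maxDiamValue n t)) ∧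
    -- the maximum over all divisor sets of any cardinality, and its attainment
    IsGreatest {m : ℕ | ∃ D : Finset ℕ, IntegralCirculant.IsConnectedDivisorSet n D ∧
        (IntegralCirculant.icg n D).diam = m}
      (IntegralCirculant.overallMaxValue n) ∧
    (∃ D : Finset ℕ, IntegralCirculant.IsConnectedDivisorSet n D ∧
      D.card ≤ IntegralCirculant.numPrimes n ∧
      (IntegralCirculant.icg n D).diam = IntegralCirculant.overallMaxValue n) := by
  have : NeZero n := ⟨by omega⟩
  obtain ⟨t₀, ht₀, ht₀k, hmax⟩ := IntegralCirculant.exists_maxDiamValue_eq_overallMaxValue hn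
  obtain ⟨D₀, hD₀, hD₀c, hD₀d⟩ := IntegralCirculant.exists_isIrredundant ht₀ ht₀k
  refine ⟨fun t ht htk => ⟨IntegralCirculant.exists_isIrredundant ht htk, ?_⟩,
    fun t ht htk h => ⟨?_, ?_⟩, ⟨⟨D₀, hD₀.1, hD₀d.trans hmax⟩, ?_⟩,
    ⟨D₀, hD₀.1, hD₀c.trans_le ht₀k, hD₀d.trans hmax⟩⟩
  · rintro m ⟨D, hD, rfl, rfl⟩
    exact ENat.toNat_le_of_le_natCast hD.card_le_and_diam_le.2
  · obtain ⟨D, hD, hc, hd⟩ := IntegralCirculant.exists_isIrredundant ht htk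
    exact ⟨D, hD.1, hc, hd⟩
  · rintro m ⟨D, hD, rfl, rfl⟩
    obtain ⟨t', -, htt, -, hd⟩ := hD.exists_diam_le hn
    exact hd.trans (IntegralCirculant.maxDiamValue_mono htt htk h)
  · rintro m ⟨D, hD, rfl⟩
    obtain ⟨t', -, -, htk, hd⟩ := hD.exists_diam_le hn
    exact hd.trans (IntegralCirculant.maxDiamValue_le_overallMaxValue htk)
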